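/- Let $\mathbb{R}^{4,2}$ be $\mathbb{R}^6$ with a symmetric bilinear form $\langle\cdot,\cdot\rangle$ of signature $(4,2)$. For $\mathfrak a$ with $\langle\mathfrak a,\mathfrak a\rangle\neq 0$ the Lie inversion $\sigma_a$ is the linear map $\sigma_a(\mathfrak r)=\mathfrak r-\frac{2\langle\mathfrak r,\mathfrak a\rangle}{\langle\mathfrak a,\mathfrak a\rangle}\mathfrak a$. Spheres are the null lines of $\mathbb{R}^{4,2}$, and a contact element is a $2$-dimensional totally isotropic subspace. A Legendre map is a smooth immersed family $f$ of contact elements over a surface $M^2$ such that $\langle \mathfrak s_1,d\mathfrak s_2\rangle=0$ for all local smooth sections $\mathfrak s_1,\mathfrak s_2$ of $f$. A curvature direction of $f$ at $p$ is a tangent vector $X\neq 0$ for which some local smooth section $\mathfrak s$ of $f$ satisfies $\mathfrak s(p)\ne 0$ and $d_X\mathfrak s\in f(p)$. Two Legendre maps $f,\hat f$ on $M^2$ form a Ribaucour pair if $f(p)\cap\hat f(p)$ is exactly one sphere $r(p)$ for every $p\in M^2$ (so that both envelop the sphere congruence $r$) and $f,\hat f$ have the same curvature directions at every point. A Dupin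 cyclide $\Delta$ is an orthogonal splitting $\mathbb{R}^{4,2}=D_1\oplus_\perp D_2$ into two $3$-dimensional subspaces of signature $(2,1)$; its contact elements are the subspaces $\operatorname{span}(\mathfrak s^1,\mathfrak s^2)$ with nonzero null vectors $\mathfrak s^1\in D_1$, $\mathfrak s^2\in D_2$. Two Dupin cyclides $\Delta,\hat\Delta$ are Ribaucour related if over some connected surface patch (a nonempty connected open subset of $\mathbb{R}^2$) there are Legendre maps $f,\hat f$, whose values are contact elements of $\Delta$ and of $\hat\Delta$ respectively, that form a Ribaucour pair. Proposition. Two Dupin cyclides $\Delta$ and $\hat\Delta$ are Ribaucour related if and only if, for a suitable labelling of the splittings $\Delta=D_1\oplus_\perp D_2$ and $\hat\Delta=\hat D_1\oplus_\perp\hat D_2$, there is a single Lie inversion $\sigma$ such that $\hat D_1=\sigma(D_1)$ and $\hat D_2=\sigma(D_2)$. -/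

import Mathlib

open scoped ContDiff

namespace LieSphere

/-- The underlying vector space of `ℝ^{4,2}`. -/
abbrev R42 : Type := Fin 6 → ℝ

/-- The metric `⟨x, y⟩ = x₀y₀ + x₁y₁ + x₂y₂ + x₃y₃ - x₄y₄ - x₅y₅` of signature `(4,2)`. -/
noncomputable def form : LinearMap.BilinForm ℝ R42 :=
  Matrix.toBilin' (Matrix.diagonal ![1, 1, 1, 1, -1, -1])

/-- The Lie inversion `σ_a : r ↦ r - (2⟨r, a⟩ / ⟨a, a⟩) a`; it is meaningful for `⟨a, a⟩ ≠ 0`. -/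
noncomputable def lieInversion (a : R42) : R42 →ₗ[ℝ] R42 where
  toFun r := r - (2 * form r a / form a a) • a
  map_add' x y := by
    simp only [map_add, LinearMap.add_apply]
    module
  map_smul' c x := by
    simp only [map_smul, LinearMap.smul_apply, smul_eq_mul, RingHom.id_apply]
    module

/-- `σ` is the Lie inversion with respect to some elliptic or hyperbolic linear sphere complex. -/
def IsLieInversion (σ : R42 →ₗ[ℝ] R42) : Prop :=
  ∃ a : R42, form a a ≠ 0 ∧ σ = lieInversion a

/-- `D` is a `(2,1)`-plane: a 3-dimensional subspace on which the metric has signature `(2,1)`,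
i.e. it has a pseudo-orthonormal basis of type `(+,+,-)`. -/
def IsPlane21 (D : Submodule ℝ R42) : Prop :=
  ∃ b : Fin 3 → R42, LinearIndependent ℝ b ∧ Submodule.span ℝ (Set.range b) = D ∧
    ∀ i j, form (b i) (b j) = if i = j then ![(1 : ℝ), 1, -1] i else 0

/-- A contact element: a 2-dimensional totally isotropic subspace, that is, a line in the Lie
quadric. -/
def IsContactElement (c : Submodule ℝ R42) : Prop :=
  Module.finrank ℝ c = 2 ∧ ∀ x ∈ c, ∀ y ∈ c, form x y = 0

/-- `s` is, near `p`, a smooth section of the family of subspaces `f`. -/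
def IsSmoothSectionAt (f : ℝ × ℝ → Submodule ℝ R42) (p : ℝ × ℝ) (s : ℝ × ℝ → R42) : Prop :=
  ∃ W : Set (ℝ × ℝ), IsOpen W ∧ p ∈ W ∧ ContDiffOn ℝ ∞ s W ∧ ∀ q ∈ W, s q ∈ f q

/-- `f` is a Legendre map on the open set `U`: a smooth 2-parameter (i.e. immersed) family of
contact elements that satisfies the contact condition `⟨s, dt⟩ = 0` for all sections `s, t`. -/
structure IsLegendreMap (U : Set (ℝ × ℝ)) (f : ℝ × ℝ → Submodule ℝ R42) : Prop where
  contactElement : ∀ p ∈ U, IsContactElement (f p)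
  smooth : ∀ p ∈ U, ∃ (W : Set (ℝ × ℝ)) (s t : ℝ × ℝ → R42), IsOpen W ∧ p ∈ W ∧
    ContDiffOn ℝ ∞ s W ∧ ContDiffOn ℝ ∞ t W ∧ ∀ q ∈ W, f q = Submodule.span ℝ {s q, t q}
  contact : ∀ p ∈ U, ∀ s t : ℝ × ℝ → R42, IsSmoothSectionAt f p s → IsSmoothSectionAt f p t →
    ∀ X : ℝ × ℝ, form (s p) (fderiv ℝ t p X) = 0
  immersion : ∀ p ∈ U, ∀ X : ℝ × ℝ,
    (∀ s : ℝ × ℝ → R42, IsSmoothSectionAt f p s → fderiv ℝ s p X ∈ f p) → X = 0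

/-- The nonzero tangent vector `X` at `p` is a curvature direction of `f`: some sphere `⟨s(p)⟩` of
the contact element `f(p)` (the curvature sphere) is in contact of higher order along `X`, i.e.
`s` is a smooth section of `f` with `s(p) ≠ 0` and `d_X s ∈ f(p)`. -/
def IsCurvatureDirection (f : ℝ × ℝ → Submodule ℝ R42) (p X : ℝ × ℝ) : Prop :=
  X ≠ 0 ∧ ∃ s : ℝ × ℝ → R42, IsSmoothSectionAt f p s ∧ s p ≠ 0 ∧ fderiv ℝ s p X ∈ f p

/-- `f` and `g` form a Ribaucour pair: they are Legendre maps which at each point have exactly one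
common sphere `r = f ∩ g` (so both envelop the sphere congruence `r`), and their curvature
directions, hence their curvature lines, correspond. -/
structure IsRibaucourPair (U : Set (ℝ × ℝ)) (f g : ℝ × ℝ → Submodule ℝ R42) : Prop where
  legendre_left : IsLegendreMap U f
  legendre_right : IsLegendreMap U g
  common_sphere : ∀ p ∈ U, Module.finrank ℝ (f p ⊓ g p : Submodule ℝ R42) = 1
  curvature : ∀ p ∈ U, ∀ X : ℝ × ℝ, IsCurvatureDirection f p X ↔ IsCurvatureDirection g p X

/-- A Dupin cyclide, given (with some labelling) by an orthogonal splitting of `ℝ^{4,2}` into two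
`(2,1)`-planes. -/
structure DupinCyclide where
  plane : Fin 2 → Submodule ℝ R42
  isPlane21 : ∀ i, IsPlane21 (plane i)
  isCompl : IsCompl (plane 0) (plane 1)
  orthogonal : ∀ x ∈ plane 0, ∀ y ∈ plane 1, form x y = 0

/-- The contact elements of a Dupin cyclide: those spanned by a curvature sphere in one plane and a
curvature sphere in the other one. -/
def DupinCyclide.contactElements (Δ : DupinCyclide) : Set (Submodule ℝ R42) :=
  {c | ∃ s : Fin 2 → R42, (∀ i, s i ∈ Δ.plane i ∧ s i ≠ 0 ∧ form (s i) (s i) = 0) ∧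
    c = Submodule.span ℝ (Set.range s)}

/-- Two Dupin cyclides are Ribaucour related (form a Ribaucour pair): they have simultaneous
parametrizations over a surface patch, as Legendre maps, that form a Ribaucour pair. -/
def DupinCyclide.RibaucourRelated (Δ Δ' : DupinCyclide) : Prop :=
  ∃ (U : Set (ℝ × ℝ)) (f f' : ℝ × ℝ → Submodule ℝ R42), IsOpen U ∧ IsConnected U ∧
    (∀ p ∈ U, f p ∈ Δ.contactElements) ∧ (∀ p ∈ U, f' p ∈ Δ'.contactElements) ∧
    IsRibaucourPair U f f'

end LieSphere

/-!
The curvature spheres of a Dupin cyclide run along two conics, and a Legendre map into its contact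
elements is a pair of conic parameters `u = (u₀, u₁)` with invertible derivative whose coordinate
directions are the curvature directions. If the curvature directions of two such maps `u`, `u'`
agree, then near a point each coordinate of `u'` is, up to the labelling, an injective function of
one coordinate of `u` alone. Hence there are families `s i`, `s' i` of curvature spheres, indexed
by infinite sets, such that *every* choice of `t 0` and `t 1` makes `span (s 0 (t 0), s 1 (t 1))`
meet `span (s' 0 (t 0), s' 1 (t 1))`; then also every line joining `s 0 t` to `s' 0 t` meets every
line joining `s 1 v` to `s' 1 v`.

Unless the two splittings agree, infinitely many of these joins are projective lines. Meeting
pairwise in this way and spanning enough of the space, they pass through one point `⟨a⟩`. Since `a`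
is in the span of the null vectors `s i t` and `s' i t`, the Lie inversion in `a` interchanges
their lines, and so it maps one splitting to the other.

Conversely, the Lie inversion in `a` fixes exactly the vectors orthogonal to `a`, so a contact
element not orthogonal to `a` shares exactly one sphere with its image, and the image of the
parametrization by the conics has the same curvature directions.
-/

namespace LieSphere

open Module Submodule
open scoped Topology

section Incidence

variable {K V : Type*} [DivisionRing K] [AddCommGroup V] [Module K V]

lemma isAtom_inf_of_finrank_eq_two {W P : Submodule K V} (hW : finrank K W = 2)
    (hWP : ¬ W ≤ P) (hmeet : ¬ Disjoint W P) : IsAtom (W ⊓ P) := by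
  have : FiniteDimensional K W := FiniteDimensional.of_finrank_eq_succ hW
  have hpos : 1 ≤ finrank K (W ⊓ P : Submodule K V) :=
    one_le_finrank_iff.2 (disjoint_iff.not.1 hmeet)
  have hlt : finrank K (W ⊓ P : Submodule K V) < finrank K W :=
    finrank_lt_finrank_of_lt (inf_lt_left.2 hWP)
  exact isAtom_iff_finrank_eq_one.2 (by omega)

lemma le_sup_of_finrank_eq_two {W X Y : Submodule K V} (hW : finrank K W = 2)
    (hX : ¬ Disjoint W X) (hY : ¬ Disjoint W Y) (hXY : Disjoint W (X ⊓ Y)) : W ≤ X ⊔ Y := by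
  by_contra hle
  have hatom : IsAtom (W ⊓ (X ⊔ Y)) :=
    isAtom_inf_of_finrank_eq_two hW hle fun h => hX (h.mono_right le_sup_left)
  have hWX := (hatom.le_iff_eq (disjoint_iff.not.1 hX)).1 (inf_le_inf_left _ le_sup_left)
  have hWY := (hatom.le_iff_eq (disjoint_iff.not.1 hY)).1 (inf_le_inf_left _ le_sup_right)
  rw [disjoint_iff, inf_inf_distrib_left, hWX, hWY, inf_idem] at hXY
  exact hatom.ne_bot hXY

lemma exists_not_le_of_finrank_lt_finrank_iSup {I : Type*} {W : I → Submodule K V}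
    {P : Submodule K V} [FiniteDimensional K P]
    (h : finrank K P < finrank K (⨆ i, W i : Submodule K V)) : ∃ i, ¬ W i ≤ P := by
  by_contra! hle
  exact h.not_ge (finrank_mono (iSup_le hle))

variable {I J : Type*} {W : I → Submodule K V} {W' : J → Submodule K V}

lemma exists_isAtom_le_of_pairwise_meet (hW : ∀ i, finrank K (W i) = 2)
    (hmeet : ∀ i j, ¬ Disjoint (W i) (W j)) (hdim : 3 < finrank K (⨆ i, W i : Submodule K V)) :
    ∃ A : Submodule K V, IsAtom A ∧ ∀ i, A ≤ W i := by
  have hfin i : FiniteDimensional K (W i) := FiniteDimensional.of_finrank_eq_succ (hW i)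
  obtain ⟨i, -⟩ : ∃ i, ¬ W i ≤ ⊥ :=
    exists_not_le_of_finrank_lt_finrank_iSup (by rw [finrank_bot]; omega)
  obtain ⟨j, hj⟩ : ∃ j, ¬ W j ≤ W i :=
    exists_not_le_of_finrank_lt_finrank_iSup (by rw [hW]; omega)
  have hA : IsAtom (W j ⊓ W i) := isAtom_inf_of_finrank_eq_two (hW j) hj (hmeet j i)
  obtain ⟨l, hl⟩ : ∃ l, ¬ W l ≤ W j ⊔ W i := by
    have hsum := finrank_sup_add_finrank_inf_eq (W j) (W i)
    rw [hW, hW, isAtom_iff_finrank_eq_one.1 hA] at hsum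
    exact exists_not_le_of_finrank_lt_finrank_iSup (by omega)
  have hout : ∀ k, ¬ W k ≤ W j ⊔ W i → W j ⊓ W i ≤ W k := fun k hk => by
    by_contra h
    exact hk (le_sup_of_finrank_eq_two (hW k) (hmeet k j) (hmeet k i)
      (hA.not_le_iff_disjoint.1 h).symm)
  refine ⟨W j ⊓ W i, hA, fun k => ?_⟩
  by_cases hk : W k ≤ W j ⊔ W i
  · have hmono : W l ⊓ W k ≤ W l ⊓ (W j ⊔ W i) := inf_le_inf_left _ hk
    have hatom : IsAtom (W l ⊓ (W j ⊔ W i)) :=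
      isAtom_inf_of_finrank_eq_two (hW l) hl fun h => hmeet l k (h.mono_right hk)
    calc W j ⊓ W i = W l ⊓ (W j ⊔ W i) :=
          (hatom.le_iff_eq hA.ne_bot).1 (le_inf (hout l hl) (inf_le_left.trans le_sup_left))
      _ = W l ⊓ W k := ((hatom.le_iff_eq (disjoint_iff.not.1 (hmeet l k))).1 hmono).symm
      _ ≤ W k := inf_le_right
  · exact hout k hk

lemma exists_isAtom_le_of_meet_of_pairwise_meet (hW : ∀ i, finrank K (W i) = 2)
    (hW' : ∀ j, finrank K (W' j) = 2) (hmeet : ∀ i j, ¬ Disjoint (W i) (W' j))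
    (hmeetW : ∀ i j, ¬ Disjoint (W i) (W j))
    (hdim : 3 < finrank K (⨆ i, W i : Submodule K V)) :
    ∃ A : Submodule K V, IsAtom A ∧ (∀ i, A ≤ W i) ∧ ∀ j, A ≤ W' j := by
  obtain ⟨A, hA, hAW⟩ := exists_isAtom_le_of_pairwise_meet hW hmeetW hdim
  refine ⟨A, hA, hAW, fun j => ?_⟩
  by_contra hj
  have hA1 : finrank K A = 1 := isAtom_iff_finrank_eq_one.1 hA
  have : FiniteDimensional K A := FiniteDimensional.of_finrank_eq_succ hA1
  have : FiniteDimensional K (W' j) := FiniteDimensional.of_finrank_eq_succ (hW' j)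
  obtain ⟨i, hi⟩ : ∃ i, ¬ W i ≤ W' j ⊔ A := by
    have hsum := finrank_add_le_finrank_add_finrank (W' j) A
    rw [hW', hA1] at hsum
    exact exists_not_le_of_finrank_lt_finrank_iSup (by omega)
  refine hi (le_sup_of_finrank_eq_two (hW i) (hmeet i j) (fun h => hA.ne_bot ?_) ?_)
  · exact disjoint_self.1 (h.mono_left (hAW i))
  · rw [(hA.not_le_iff_disjoint.1 hj).symm.eq_bot]
    exact disjoint_bot_right

/-- Otherwise some two lines of each family are disjoint, and either pair spans a solid containing
the other family, hence both. -/
lemma exists_isAtom_le_of_meet (hW : ∀ i, finrank K (W i) = 2) (hW' : ∀ j, finrank K (W' j) = 2)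
    (hmeet : ∀ i j, ¬ Disjoint (W i) (W' j)) (hdim : 3 < finrank K (⨆ i, W i : Submodule K V))
    (hdim' : 3 < finrank K (⨆ j, W' j : Submodule K V))
    (hdim_sup : 4 < finrank K ((⨆ i, W i) ⊔ ⨆ j, W' j : Submodule K V)) :
    ∃ A : Submodule K V, IsAtom A ∧ (∀ i, A ≤ W i) ∧ ∀ j, A ≤ W' j := by
  have hmeet' : ∀ j i, ¬ Disjoint (W' j) (W i) := fun j i h => hmeet i j h.symm
  by_cases hmeetW : ∀ i j, ¬ Disjoint (W i) (W j)
  · exact exists_isAtom_le_of_meet_of_pairwise_meet hW hW' hmeet hmeetW hdim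
  by_cases hmeetW' : ∀ i j, ¬ Disjoint (W' i) (W' j)
  · obtain ⟨A, hA, hAW', hAW⟩ :=
      exists_isAtom_le_of_meet_of_pairwise_meet hW' hW hmeet' hmeetW' hdim'
    exact ⟨A, hA, hAW, hAW'⟩
  push Not at hmeetW hmeetW'
  obtain ⟨i₁, i₂, hi⟩ := hmeetW
  obtain ⟨j₁, j₂, hj⟩ := hmeetW'
  have hleW' : ∀ j, W' j ≤ W i₁ ⊔ W i₂ := fun j =>
    le_sup_of_finrank_eq_two (hW' j) (hmeet' j i₁) (hmeet' j i₂)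
      (hi.eq_bot ▸ disjoint_bot_right)
  have hleW : ∀ i, W i ≤ W i₁ ⊔ W i₂ := fun i =>
    (le_sup_of_finrank_eq_two (hW i) (hmeet i j₁) (hmeet i j₂)
      (hj.eq_bot ▸ disjoint_bot_right)).trans (sup_le (hleW' j₁) (hleW' j₂))
  have hfin i : FiniteDimensional K (W i) := FiniteDimensional.of_finrank_eq_succ (hW i)
  have hle : (⨆ i, W i) ⊔ ⨆ j, W' j ≤ W i₁ ⊔ W i₂ := sup_le (iSup_le hleW) (iSup_le hleW')
  have hsum := finrank_add_le_finrank_add_finrank (W i₁) (W i₂)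
  rw [hW, hW] at hsum
  exact absurd hsum (hdim_sup.trans_le (finrank_mono hle)).not_ge

end Incidence

lemma not_disjoint_span_pair_of_not_disjoint_span_range {K V : Type*} [Field K]
    [AddCommGroup V] [Module K V] {s s' : Fin 2 → V}
    (hli : ∀ i, LinearIndependent K ![s i, s' i])
    (hmeet : ¬ Disjoint (span K (Set.range s)) (span K (Set.range s'))) :
    ¬ Disjoint (span K {s 0, s' 0}) (span K {s 1, s' 1}) := by
  rw [disjoint_def] at hmeet ⊢
  push Not at hmeet
  obtain ⟨r, hr, hr', hr0⟩ := hmeet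
  obtain ⟨c, rfl⟩ := (mem_span_range_iff_exists_fun K).1 hr
  obtain ⟨c', hc'⟩ := (mem_span_range_iff_exists_fun K).1 hr'
  simp only [Fin.sum_univ_two] at hc' hr0
  intro h
  have hzero := h (c 0 • s 0 + (-c' 0) • s' 0) (mem_span_pair.2 ⟨_, _, rfl⟩)
    (mem_span_pair.2 ⟨-c 1, c' 1, by linear_combination (norm := module) hc'⟩)
  obtain ⟨hc0, -⟩ := LinearIndependent.pair_iff.1 (hli 0) _ _ hzero
  have hone : c 1 • s 1 + (-c' 1) • s' 1 = 0 := by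
    linear_combination (norm := module) -hzero - hc'
  obtain ⟨hc1, -⟩ := LinearIndependent.pair_iff.1 (hli 1) _ _ hone
  exact hr0 (by rw [hc0, hc1, zero_smul, zero_smul, add_zero])

lemma finrank_inf_ker_add_one {K V : Type*} [Field K] [AddCommGroup V] [Module K V]
    {P : Submodule K V} [FiniteDimensional K P] {φ : V →ₗ[K] K} {x : V} (hx : x ∈ P)
    (hφ : φ x ≠ 0) :
    finrank K (P ⊓ LinearMap.ker φ : Submodule K V) + 1 = finrank K P := by
  have hne : φ.domRestrict P ≠ 0 := fun h => hφ (LinearMap.congr_fun h ⟨x, hx⟩)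
  rw [← Dual.finrank_ker_add_one_of_ne_zero hne, LinearMap.ker_domRestrict,
    ← finrank_map_subtype_eq P, map_comap_subtype]

section NullFamily

variable {K V I : Type*} [Field K] [AddCommGroup V] [Module K V]

/-- A family of null vectors of `D` for the bilinear form `B`, in general position: a subspace not
containing `D` contains only finitely many of its members. The points of a conic are the example. -/
structure IsNullFamily (B : LinearMap.BilinForm K V) (D : Submodule K V) (s : I → V) : Prop where
  mem : ∀ t, s t ∈ D
  null : ∀ t, B (s t) (s t) = 0
  finite_mem : ∀ P : Submodule K V, ¬ D ≤ P → {t | s t ∈ P}.Finite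

variable {B : LinearMap.BilinForm K V} {D D' P : Submodule K V} {s s' : I → V}

lemma IsNullFamily.le_of_forall_mem (h : IsNullFamily B D s) {S : Set I} (hS : S.Infinite)
    (hP : ∀ t ∈ S, s t ∈ P) : D ≤ P := by
  by_contra hle
  exact hS ((h.finite_mem P hle).subset hP)

lemma IsNullFamily.infinite_linearIndependent [Infinite I] (h : IsNullFamily B D s)
    (h' : IsNullFamily B D' s') (hle : ¬ D ≤ D') (hbot : D' ≠ ⊥) :
    {t | LinearIndependent K ![s t, s' t]}.Infinite := by
  have hfin : ({t | s t ∈ D'} ∪ {t | s' t ∈ (⊥ : Submodule K V)}).Finite :=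
    (h.finite_mem D' hle).union (h'.finite_mem ⊥ (mt le_bot_iff.1 hbot))
  refine hfin.infinite_compl.mono fun t ht => ?_
  simp only [Set.mem_compl_iff, Set.mem_union, Set.mem_ofPred_eq, mem_bot, not_or] at ht
  refine LinearIndependent.pair_symm_iff.1 ((LinearIndependent.pair_iff' ht.2).2 ?_)
  exact fun c hc => ht.1 (hc ▸ smul_mem _ c (h'.mem t))

lemma IsNullFamily.sup_le_iSup_span_pair (h : IsNullFamily B D s) (h' : IsNullFamily B D' s')
    {S : Set I} (hS : S.Infinite) : D ⊔ D' ≤ ⨆ t : S, span K {s t, s' t} := by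
  have hmem : ∀ t ∈ S, {s t, s' t} ⊆ ((⨆ t : S, span K {s t, s' t} : Submodule K V) : Set V) :=
    fun t ht => span_le.1 (le_iSup (fun t : S => span K {s t, s' t}) ⟨t, ht⟩)
  exact sup_le (h.le_of_forall_mem hS fun t ht => hmem t ht (Set.mem_insert _ _))
    (h'.le_of_forall_mem hS fun t ht => hmem t ht (Set.mem_insert_of_mem _ rfl))

lemma apply_self_of_mem_span_pair (hB : B.IsSymm) {x y a : V} (hx : B x x = 0) (hy : B y y = 0)
    {c d : K} (ha : c • x + d • y = a) : B a a = 2 * c * B x a := by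
  have hyx := hB.eq y x
  simp only [← ha, map_add, map_smul, LinearMap.add_apply, LinearMap.smul_apply, smul_eq_mul,
    hx, hy]
  linear_combination d * c * hyx

lemma apply_eq_zero_of_mem_span_pair [NeZero (2 : K)] (hB : B.IsSymm) {x y a : V}
    (hx : B x x = 0) (hy : B y y = 0) (ha : a ∈ span K {x, y}) (ha0 : a ≠ 0) (hnull : B a a = 0)
    (hya : y ∉ span K {a}) : B x a = 0 := by
  obtain ⟨c, d, hcd⟩ := mem_span_pair.1 ha
  have hc : c ≠ 0 := by
    rintro rfl
    have hd : d ≠ 0 := by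
      rintro rfl
      exact ha0 (by rw [← hcd, zero_smul, zero_smul, add_zero])
    refine hya (mem_span_singleton.2 ⟨d⁻¹, ?_⟩)
    rw [← hcd, zero_smul, zero_add, inv_smul_smul₀ hd]
  rw [apply_self_of_mem_span_pair hB hx hy hcd] at hnull
  exact (mul_eq_zero.1 hnull).resolve_left (mul_ne_zero two_ne_zero hc)

lemma IsNullFamily.apply_eq_zero [NeZero (2 : K)] (hB : B.IsSymm) (h : IsNullFamily B D s)
    (h' : IsNullFamily B D' s') (hrank : 1 < finrank K D') {S : Set I} (hS : S.Infinite) {a : V}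
    (ha0 : a ≠ 0) (hnull : B a a = 0) (ha : ∀ t ∈ S, a ∈ span K {s t, s' t}) :
    ∀ x ∈ D, B x a = 0 := by
  have hline : ¬ D' ≤ span K {a} := fun hle =>
    (hrank.trans_le (finrank_mono hle)).ne' (finrank_span_singleton ha0)
  have hle : D ≤ LinearMap.ker (B.flip a) := h.le_of_forall_mem (hS.sdiff (h'.finite_mem _ hline))
    fun t ht => apply_eq_zero_of_mem_span_pair hB (h.null t) (h'.null t) (ha t ht.1) ha0 hnull ht.2
  exact fun x hx => hle hx

end NullFamily

section NullFrame

variable {K V : Type*} [Field K] [AddCommGroup V] [Module K V]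

/-- A basis of a 3-dimensional space, two null vectors and a unit vector, adapted to the
parametrization of its null lines by `conic`. -/
def IsNullFrame (B : LinearMap.BilinForm K V) (b : Fin 3 → V) : Prop :=
  ∀ i j, B (b i) (b j) = !![0, 0, -1; 0, 1, 0; -1, 0, 0] i j

/-- The rational parametrization of the null lines of a null frame other than the line of `b 2`. -/
def conic (b : Fin 3 → V) (t : K) : V := b 0 + t • b 1 + (t ^ 2 / 2) • b 2

/-- The velocity of `conic b`. -/
def conicDeriv (b : Fin 3 → V) (t : K) : V := b 1 + t • b 2

/-- The parameter of the point of the conic proportional to `x`, meaningful for null vectors `x`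
not orthogonal to `b 2`. -/
def conicParam (B : LinearMap.BilinForm K V) (b : Fin 3 → V) (x : V) : K := -B x (b 1) / B x (b 2)

variable {B : LinearMap.BilinForm K V} {b : Fin 3 → V}

lemma conic_mem_span (b : Fin 3 → V) (t : K) : conic b t ∈ span K (Set.range b) :=
  add_mem (add_mem (subset_span ⟨0, rfl⟩) (smul_mem _ _ (subset_span ⟨1, rfl⟩)))
    (smul_mem _ _ (subset_span ⟨2, rfl⟩))

lemma conicDeriv_mem_span (b : Fin 3 → V) (t : K) : conicDeriv b t ∈ span K (Set.range b) :=
  add_mem (subset_span ⟨1, rfl⟩) (smul_mem _ _ (subset_span ⟨2, rfl⟩))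

lemma map_conic {V' : Type*} [AddCommGroup V'] [Module K V'] (f : V →ₗ[K] V') (b : Fin 3 → V)
    (t : K) : f (conic b t) = conic (f ∘ b) t := by
  simp only [conic, map_add, map_smul, Function.comp_apply]

lemma map_span_conic {ι V' : Type*} [AddCommGroup V'] [Module K V'] (f : V →ₗ[K] V')
    (b : ι → Fin 3 → V) (t : ι → K) :
    (span K (Set.range fun i => conic (b i) (t i))).map f =
      span K (Set.range fun i => conic (f ∘ b i) (t i)) := by
  rw [map_span, ← Set.range_comp]
  exact congrArg _ (congrArg _ (funext fun i => map_conic f (b i) (t i)))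

lemma conicParam_smul (B : LinearMap.BilinForm K V) (b : Fin 3 → V) {c : K} (hc : c ≠ 0) (x : V) :
    conicParam B b (c • x) = conicParam B b x := by
  simp only [conicParam, map_smul, LinearMap.smul_apply, smul_eq_mul, ← mul_neg]
  exact mul_div_mul_left _ _ hc

lemma finite_conic_mem [NeZero (2 : K)] {P : Submodule K V}
    (hP : ¬ span K (Set.range b) ≤ P) : {t : K | conic b t ∈ P}.Finite := by
  obtain ⟨i, hi⟩ : ∃ i, b i ∉ P := by
    by_contra! h
    exact hP (span_le.2 (Set.range_subset_iff.2 h))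
  obtain ⟨φ, hφ, hker⟩ := exists_le_ker_of_notMem hi
  let p : Polynomial K := .C (φ (b 0)) + .C (φ (b 1)) * .X + .C (φ (b 2) / 2) * .X ^ 2
  have hp : p ≠ 0 := fun h => hφ <| by
    have hcoeff n : p.coeff n = 0 := by rw [h, Polynomial.coeff_zero]
    have h0 : φ (b 0) = 0 := by simpa [p] using hcoeff 0
    have h1 : φ (b 1) = 0 := by simpa [p] using hcoeff 1
    have h2 : φ (b 2) = 0 := by
      simpa [p, Polynomial.coeff_X, Polynomial.coeff_C, two_ne_zero] using hcoeff 2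
    fin_cases i
    exacts [h0, h1, h2]
  refine (Polynomial.finite_setOfPred_isRoot hp).subset fun t ht => ?_
  have hroot : φ (conic b t) = 0 := hker ht
  simp only [conic, map_add, map_smul, smul_eq_mul] at hroot
  simp only [Set.mem_ofPred_eq, Polynomial.IsRoot, p, Polynomial.eval_add, Polynomial.eval_mul,
    Polynomial.eval_C, Polynomial.eval_X, Polynomial.eval_pow]
  linear_combination hroot

namespace IsNullFrame

lemma apply_sum (hb : IsNullFrame B b) (c : Fin 3 → K) (j : Fin 3) :
    B (∑ i, c i • b i) (b j) = ![-c 2, c 1, -c 0] j := by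
  fin_cases j <;> simp [Fin.sum_univ_three, hb _ _]

lemma apply_sum_self (hb : IsNullFrame B b) (c : Fin 3 → K) :
    B (∑ i, c i • b i) (∑ i, c i • b i) = c 1 ^ 2 - 2 * c 0 * c 2 := by
  have hexpand x : B x (∑ i, c i • b i) = ∑ i, c i * B x (b i) := by
    simp only [map_sum, map_smul, smul_eq_mul]
  simp only [hexpand, hb.apply_sum]
  simp only [Fin.sum_univ_three, Matrix.cons_val]
  ring

lemma apply_conic_two (hb : IsNullFrame B b) (t : K) : B (conic b t) (b 2) = -1 := by
  simp [conic, hb _ _]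

lemma conic_ne_zero (hb : IsNullFrame B b) (t : K) : conic b t ≠ 0 := fun h => by
  simpa [h] using hb.apply_conic_two t

lemma apply_conicDeriv_conicDeriv (hb : IsNullFrame B b) (t : K) :
    B (conicDeriv b t) (conicDeriv b t) = 1 := by
  simp [conicDeriv, hb _ _]

lemma apply_conic_conicDeriv (hb : IsNullFrame B b) (t : K) :
    B (conic b t) (conicDeriv b t) = 0 := by
  simp [conic, conicDeriv, hb _ _]

lemma comp_rev (hb : IsNullFrame B b) : IsNullFrame B (b ∘ Fin.rev) := fun i j => by
  rw [Function.comp_apply, Function.comp_apply, hb]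
  fin_cases i <;> fin_cases j <;> rfl

lemma exists_apply_two_ne_zero (hb : IsNullFrame B b) {x : V} (hx : x ∈ span K (Set.range b))
    (hx0 : x ≠ 0) (hnull : B x x = 0) :
    ∃ b' : Fin 3 → V, IsNullFrame B b' ∧ Set.range b' = Set.range b ∧ B x (b' 2) ≠ 0 := by
  by_cases h2 : B x (b 2) = 0
  · refine ⟨b ∘ Fin.rev, hb.comp_rev, Fin.rev_surjective.range_comp b, fun h0 => hx0 ?_⟩
    obtain ⟨c, rfl⟩ := (mem_span_range_iff_exists_fun K).1 hx
    have hc0 : c 0 = 0 := neg_eq_zero.1 ((hb.apply_sum c 2).symm.trans h2)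
    have hc2 : c 2 = 0 := neg_eq_zero.1 ((hb.apply_sum c 0).symm.trans h0)
    have hc1 : c 1 = 0 := by
      rw [hb.apply_sum_self, hc2, mul_zero, sub_zero] at hnull
      exact pow_eq_zero_iff two_ne_zero |>.1 hnull
    simp only [Fin.sum_univ_three, hc0, hc1, hc2, zero_smul, add_zero]
  · exact ⟨b, hb, rfl, h2⟩

variable [NeZero (2 : K)]

lemma apply_conic_conic (hb : IsNullFrame B b) (t : K) : B (conic b t) (conic b t) = 0 := by
  have hsum : conic b t = ∑ i, ![1, t, t ^ 2 / 2] i • b i := by simp [conic, Fin.sum_univ_three]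
  rw [hsum, hb.apply_sum_self]
  simp only [Matrix.cons_val]
  field_simp
  ring

lemma eq_smul_conic (hb : IsNullFrame B b) {x : V} (hx : x ∈ span K (Set.range b))
    (hnull : B x x = 0) (h2 : B x (b 2) ≠ 0) :
    x = (-B x (b 2)) • conic b (conicParam B b x) := by
  obtain ⟨c, rfl⟩ := (mem_span_range_iff_exists_fun K).1 hx
  have hB1 : B (∑ i, c i • b i) (b 1) = c 1 := hb.apply_sum c 1
  have hB2 : B (∑ i, c i • b i) (b 2) = -c 0 := hb.apply_sum c 2
  have hc0 : c 0 ≠ 0 := neg_ne_zero.1 (hB2 ▸ h2)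
  have hc1 : c 0 * (c 1 / c 0) = c 1 := mul_div_cancel₀ _ hc0
  have hc2 : c 0 * ((c 1 / c 0) ^ 2 / 2) = c 2 := by
    rw [hb.apply_sum_self] at hnull
    field_simp
    linear_combination hnull
  rw [conicParam, hB1, hB2, neg_neg, neg_div_neg_eq, conic, smul_add, smul_add, smul_smul,
    smul_smul, hc1, hc2, Fin.sum_univ_three]

lemma isNullFamily (hb : IsNullFrame B b) {I : Type*} {k : I → K} (hk : Function.Injective k) :
    IsNullFamily B (span K (Set.range b)) fun t => conic b (k t) where
  mem t := conic_mem_span b (k t)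
  null t := hb.apply_conic_conic (k t)
  finite_mem _ hP := (finite_conic_mem hP).preimage (f := k) hk.injOn

end IsNullFrame

end NullFrame

section LieInversion

lemma form_isSymm : form.IsSymm where
  eq x y := by
    simp only [form, Matrix.toBilin'_apply', Matrix.mulVec_diagonal, dotProduct]
    exact Finset.sum_congr rfl fun i _ => by ring

lemma form_comm (x y : R42) : form x y = form y x := form_isSymm.eq x y

lemma form_nondegenerate : form.Nondegenerate :=
  LinearMap.BilinForm.nondegenerate_toBilin'_of_det_ne_zero' _ (by
    simp [Matrix.det_diagonal, Fin.prod_univ_succ])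

lemma lieInversion_apply (a x : R42) :
    lieInversion a x = x - (2 * form x a / form a a) • a := rfl

lemma lieInversion_eq_self {a x : R42} (h : form x a = 0) : lieInversion a x = x := by
  rw [lieInversion_apply, h, mul_zero, zero_div, zero_smul, sub_zero]

variable {a : R42}

lemma lieInversion_self (ha : form a a ≠ 0) : lieInversion a a = -a := by
  rw [lieInversion_apply, mul_div_cancel_right₀ _ ha]
  module

lemma lieInversion_involutive (ha : form a a ≠ 0) : Function.Involutive (lieInversion a) :=
  fun x => by
    rw [lieInversion_apply a x, map_sub, map_smul, lieInversion_self ha, lieInversion_apply]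
    module

lemma form_lieInversion (ha : form a a ≠ 0) (x y : R42) :
    form (lieInversion a x) (lieInversion a y) = form x y := by
  simp only [lieInversion_apply, map_sub, map_smul, LinearMap.sub_apply, LinearMap.smul_apply,
    smul_eq_mul]
  rw [form_comm a y]
  field_simp
  ring

lemma map_lieInversion_eq_of_le (ha : form a a ≠ 0) {D D' : Submodule ℝ R42}
    (hrank : finrank ℝ D = finrank ℝ D') (hle : D.map (lieInversion a) ≤ D') :
    D.map (lieInversion a) = D' :=
  eq_of_le_of_finrank_eq hle <|
    (equivMapOfInjective _ (lieInversion_involutive ha).injective D).finrank_eq.symm.trans hrank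

lemma lieInversion_mem_span_of_mem_span_pair (ha : form a a ≠ 0) {x y : R42} (hx : form x x = 0)
    (hy : form y y = 0) (hmem : a ∈ span ℝ {x, y}) : lieInversion a x ∈ span ℝ {y} := by
  obtain ⟨c, d, hcd⟩ := mem_span_pair.1 hmem
  have haa := apply_self_of_mem_span_pair form_isSymm hx hy hcd
  have hcx : 2 * c * form x a ≠ 0 := haa ▸ ha
  have hc : c ≠ 0 := right_ne_zero_of_mul (left_ne_zero_of_mul hcx)
  have hxa : form x a ≠ 0 := right_ne_zero_of_mul hcx
  have hcoeff : 2 * form x a / form a a = c⁻¹ := by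
    rw [haa]
    field_simp
  refine mem_span_singleton.2 ⟨-(c⁻¹ * d), ?_⟩
  rw [lieInversion_apply, hcoeff, ← hcd, smul_add, inv_smul_smul₀ hc, neg_smul, mul_smul]
  module

lemma IsNullFrame.lieInversion_comp (ha : form a a ≠ 0) {b : Fin 3 → R42}
    (hb : IsNullFrame form b) : IsNullFrame form (lieInversion a ∘ b) := fun i j =>
  (form_lieInversion ha _ _).trans (hb i j)

lemma IsNullFamily.map_lieInversion_le (ha : form a a ≠ 0) {I : Type*} {D D' : Submodule ℝ R42}
    {s s' : I → R42} (h : IsNullFamily form D s) (h' : IsNullFamily form D' s') {S : Set I}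
    (hS : S.Infinite) (hmem : ∀ t ∈ S, a ∈ span ℝ {s t, s' t}) :
    D.map (lieInversion a) ≤ D' :=
  map_le_iff_le_comap.2 <| h.le_of_forall_mem hS fun t ht =>
    (span_singleton_le_iff_mem _ _).2 (h'.mem t)
      (lieInversion_mem_span_of_mem_span_pair ha (h.null t) (h'.null t) (hmem t ht))

lemma IsContactElement.inf_map_lieInversion {c : Submodule ℝ R42} (hc : IsContactElement c)
    (ha : form a a ≠ 0) :
    c ⊓ c.map (lieInversion a) = c ⊓ LinearMap.ker (form.flip a) := by
  ext y
  simp only [mem_inf, mem_map, LinearMap.mem_ker]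
  refine and_congr_right fun hy => ⟨?_, fun h => ⟨y, hy, lieInversion_eq_self h⟩⟩
  rintro ⟨z, hz, rfl⟩
  have hnull : form z (lieInversion a z) = 0 := hc.2 z hz _ hy
  have hza : form z a = 0 := by
    rw [lieInversion_apply, map_sub, hc.2 z hz z hz, map_smul, zero_sub, smul_eq_mul] at hnull
    simpa [ha] using hnull
  rw [lieInversion_eq_self hza]
  exact hza

lemma IsContactElement.finrank_inf_map_lieInversion {c : Submodule ℝ R42}
    (hc : IsContactElement c) {x : R42} (ha : form a a ≠ 0) (hx : x ∈ c) (hxa : form x a ≠ 0) :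
    finrank ℝ (c ⊓ c.map (lieInversion a) : Submodule ℝ R42) = 1 := by
  have hrank := finrank_inf_ker_add_one (φ := form.flip a) hx hxa
  rw [hc.1, ← hc.inf_map_lieInversion ha] at hrank
  exact Nat.succ_injective hrank

end LieInversion

section Plane

variable {D : Submodule ℝ R42}

lemma IsPlane21.finrank_eq (hD : IsPlane21 D) : finrank ℝ D = 3 := by
  obtain ⟨b, hb, rfl, -⟩ := hD
  rw [finrank_span_eq_card hb, Fintype.card_fin]

lemma IsPlane21.exists_form_self_ne_zero (hD : IsPlane21 D) : ∃ x ∈ D, form x x ≠ 0 := by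
  obtain ⟨b, -, rfl, hb⟩ := hD
  exact ⟨b 0, subset_span ⟨0, rfl⟩, by simp [hb]⟩

lemma IsPlane21.exists_isNullFrame (hD : IsPlane21 D) :
    ∃ b, IsNullFrame form b ∧ span ℝ (Set.range b) = D := by
  obtain ⟨e, -, rfl, he⟩ := hD
  let b : Fin 3 → R42 := ![e 0 + e 2, e 1, (1 / 2 : ℝ) • (e 2 - e 0)]
  have hb : IsNullFrame form b := fun i j => by
    fin_cases i <;> fin_cases j <;> simp [b, he] <;> norm_num
  have heD i : e i ∈ span ℝ (Set.range e) := subset_span ⟨i, rfl⟩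
  have hbD i : b i ∈ span ℝ (Set.range b) := subset_span ⟨i, rfl⟩
  have he0 : e 0 = (1 / 2 : ℝ) • b 0 - b 2 := by
    simp only [b, Matrix.cons_val]
    module
  have he2 : e 2 = (1 / 2 : ℝ) • b 0 + b 2 := by
    simp only [b, Matrix.cons_val]
    module
  refine ⟨b, hb, le_antisymm (span_le.2 ?_) (span_le.2 ?_)⟩
  · rintro _ ⟨i, rfl⟩
    fin_cases i
    · exact add_mem (heD 0) (heD 2)
    · exact heD 1
    · exact smul_mem _ _ (sub_mem (heD 2) (heD 0))
  · rintro _ ⟨i, rfl⟩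
    fin_cases i
    · exact he0 ▸ sub_mem (smul_mem _ _ (hbD 0)) (hbD 2)
    · exact hbD 1
    · exact he2 ▸ add_mem (smul_mem _ _ (hbD 0)) (hbD 2)

end Plane

namespace DupinCyclide

variable {Δ Δ' : DupinCyclide} {i j : Fin 2}

lemma form_eq_zero (Δ : DupinCyclide) (hij : i ≠ j) {x y : R42} (hx : x ∈ Δ.plane i)
    (hy : y ∈ Δ.plane j) : form x y = 0 := by
  fin_cases i <;> fin_cases j
  · exact absurd rfl hij
  · exact Δ.orthogonal x hx y hy
  · exact (form_comm x y).trans (Δ.orthogonal y hy x hx)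
  · exact absurd rfl hij

lemma isCompl_plane (Δ : DupinCyclide) (hij : i ≠ j) : IsCompl (Δ.plane i) (Δ.plane j) := by
  fin_cases i <;> fin_cases j
  · exact absurd rfl hij
  · exact Δ.isCompl
  · exact Δ.isCompl.symm
  · exact absurd rfl hij

lemma plane_eq_orthogonal (Δ : DupinCyclide) (hij : i ≠ j) :
    Δ.plane j = form.orthogonal (Δ.plane i) := by
  refine eq_of_le_of_finrank_eq (fun y hy x hx => Δ.form_eq_zero hij hx hy) ?_
  rw [LinearMap.BilinForm.finrank_orthogonal form_nondegenerate, (Δ.isPlane21 j).finrank_eq,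
    (Δ.isPlane21 i).finrank_eq, finrank_fin_fun]

lemma plane_eq_of_plane_eq (h : Δ.plane i = Δ'.plane i) (j : Fin 2) :
    Δ.plane j = Δ'.plane j := by
  rcases eq_or_ne i j with rfl | hij
  · exact h
  · rw [Δ.plane_eq_orthogonal hij, Δ'.plane_eq_orthogonal hij, h]

lemma eq_zero_of_orthogonal (Δ : DupinCyclide) {a : R42}
    (h : ∀ i, ∀ x ∈ Δ.plane i, form x a = 0) : a = 0 := by
  have htop : ⊤ ≤ LinearMap.ker (form.flip a) :=
    Δ.isCompl.sup_eq_top.ge.trans (sup_le (h 0) (h 1))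
  exact form_nondegenerate.2 a fun x => htop (mem_top (x := x))

lemma exists_lieInversion_of_plane_eq (h : Δ.plane i = Δ'.plane i) :
    ∃ σ, IsLieInversion σ ∧ ∀ j, Δ'.plane j = (Δ.plane j).map σ := by
  obtain ⟨a, ha, ha0⟩ := (Δ.isPlane21 i).exists_form_self_ne_zero
  refine ⟨lieInversion a, ⟨a, ha0, rfl⟩, fun j => ?_⟩
  rw [← plane_eq_of_plane_eq h j, map_lieInversion_eq_of_le ha0 rfl]
  rintro _ ⟨x, hx, rfl⟩
  rcases eq_or_ne j i with rfl | hj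
  · exact sub_mem hx (smul_mem _ _ ha)
  · rwa [lieInversion_eq_self (Δ.form_eq_zero hj hx ha)]

lemma three_lt_finrank_sup_plane (h : Δ.plane i ≠ Δ'.plane i) :
    3 < finrank ℝ (Δ.plane i ⊔ Δ'.plane i : Submodule ℝ R42) := by
  refine (Δ.isPlane21 i).finrank_eq.symm.trans_lt
    (finrank_lt_finrank_of_lt (left_lt_sup.2 fun hle => h ?_))
  exact (eq_of_le_of_finrank_eq hle
    ((Δ'.isPlane21 i).finrank_eq.trans (Δ.isPlane21 i).finrank_eq.symm)).symm

lemma infinite_linearIndependent (hne : Δ.plane i ≠ Δ'.plane i) {I : Type*} [Infinite I]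
    {s s' : I → R42} (h : IsNullFamily form (Δ.plane i) s)
    (h' : IsNullFamily form (Δ'.plane i) s') :
    {t | LinearIndependent ℝ ![s t, s' t]}.Infinite := by
  refine h.infinite_linearIndependent h' (fun hle => hne ?_) fun hbot => ?_
  · exact eq_of_le_of_finrank_eq hle
      ((Δ.isPlane21 i).finrank_eq.trans (Δ'.isPlane21 i).finrank_eq.symm)
  · have hrank := (Δ'.isPlane21 i).finrank_eq
    rw [hbot, finrank_bot] at hrank
    exact absurd hrank (by norm_num)

variable {I : Fin 2 → Type*} [∀ i, Infinite (I i)] {s s' : ∀ i, I i → R42}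

lemma exists_common_mem_span_pair (hne : ∀ i, Δ.plane i ≠ Δ'.plane i)
    (h : ∀ i, IsNullFamily form (Δ.plane i) (s i))
    (h' : ∀ i, IsNullFamily form (Δ'.plane i) (s' i))
    (hmeet : ∀ t : ∀ i, I i, ¬ Disjoint (span ℝ (Set.range fun i => s i (t i)))
      (span ℝ (Set.range fun i => s' i (t i)))) :
    ∃ a ≠ 0, ∃ S : ∀ i, Set (I i), (∀ i, (S i).Infinite) ∧
      ∀ i, ∀ t ∈ S i, a ∈ span ℝ {s i t, s' i t} := by
  have hinf i := infinite_linearIndependent (hne i) (h i) (h' i)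
  obtain ⟨S, hS, hli⟩ : ∃ S : ∀ i, Set (I i), (∀ i, (S i).Infinite) ∧
      ∀ i, ∀ t ∈ S i, LinearIndependent ℝ ![s i t, s' i t] := ⟨_, hinf, fun i t ht => ht⟩
  have hrank i (t : S i) : finrank ℝ (span ℝ {s i t, s' i t}) = 2 := by
    have hcard := finrank_span_eq_card (hli i t t.2)
    rwa [Matrix.range_cons_cons_empty, Fintype.card_fin] at hcard
  have hsup i := (h i).sup_le_iSup_span_pair (h' i) (hS i)
  have hdim i := (three_lt_finrank_sup_plane (hne i)).trans_le (finrank_mono (hsup i))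
  have htop : ⊤ ≤ (⨆ t : S 0, span ℝ {s 0 t, s' 0 t}) ⊔ ⨆ t : S 1, span ℝ {s 1 t, s' 1 t} :=
    Δ.isCompl.sup_eq_top.ge.trans
      (sup_le_sup (le_sup_left.trans (hsup 0)) (le_sup_left.trans (hsup 1)))
  have hdim_sup := finrank_mono htop
  rw [finrank_top, finrank_fin_fun] at hdim_sup
  have hcross (t : S 0) (v : S 1) :
      ¬ Disjoint (span ℝ {s 0 t, s' 0 t}) (span ℝ {s 1 v, s' 1 v}) := by
    let w : ∀ i, I i := Fin.cons (t : I 0) (Fin.cons (v : I 1) finZeroElim)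
    exact not_disjoint_span_pair_of_not_disjoint_span_range (s := fun i => s i (w i))
      (s' := fun i => s' i (w i)) (Fin.forall_fin_two.2 ⟨hli 0 t t.2, hli 1 v v.2⟩) (hmeet w)
  obtain ⟨A, hA, hA0, hA1⟩ :=
    exists_isAtom_le_of_meet (hrank 0) (hrank 1) hcross (hdim 0) (hdim 1) (by omega)
  obtain ⟨a, ha, ha0⟩ := exists_mem_ne_zero_of_ne_bot hA.ne_bot
  exact ⟨a, ha0, S, hS, Fin.forall_fin_two.2
    ⟨fun t ht => hA0 ⟨t, ht⟩ ha, fun t ht => hA1 ⟨t, ht⟩ ha⟩⟩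

lemma exists_lieInversion (h : ∀ i, IsNullFamily form (Δ.plane i) (s i))
    (h' : ∀ i, IsNullFamily form (Δ'.plane i) (s' i))
    (hmeet : ∀ t : ∀ i, I i, ¬ Disjoint (span ℝ (Set.range fun i => s i (t i)))
      (span ℝ (Set.range fun i => s' i (t i)))) :
    ∃ σ, IsLieInversion σ ∧ ∀ i, Δ'.plane i = (Δ.plane i).map σ := by
  by_cases hne : ∀ i, Δ.plane i ≠ Δ'.plane i
  · obtain ⟨a, ha0, S, hS, ha⟩ := exists_common_mem_span_pair hne h h' hmeet
    have hnull : form a a ≠ 0 := fun h0 => ha0 <| Δ.eq_zero_of_orthogonal fun i =>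
      (h i).apply_eq_zero form_isSymm (h' i) (by rw [(Δ'.isPlane21 i).finrank_eq]; norm_num)
        (hS i) ha0 h0 (ha i)
    exact ⟨lieInversion a, ⟨a, hnull, rfl⟩, fun i => (map_lieInversion_eq_of_le hnull
      ((Δ.isPlane21 i).finrank_eq.trans (Δ'.isPlane21 i).finrank_eq.symm)
      ((h i).map_lieInversion_le hnull (h' i) (hS i) (ha i))).symm⟩
  · push Not at hne
    obtain ⟨i, hi⟩ := hne
    exact exists_lieInversion_of_plane_eq hi

end DupinCyclide

section CoordinateNet

variable {ι : Type*}

/-- A vector lies on a coordinate axis; for two coordinates this says that one of them vanishes. -/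
def OnAxis {K : Type*} [Zero K] (x : ι → K) : Prop := ∃ i, ∀ k ≠ i, x k = 0

lemma OnAxis.apply_eq_zero {K : Type*} [Zero K] {x : ι → K} (hx : OnAxis x) {i k : ι}
    (hi : x i ≠ 0) (hk : k ≠ i) : x k = 0 := by
  obtain ⟨j, hj⟩ := hx
  have hij : i = j := by_contra fun h => hi (hj i h)
  exact hj k (hij ▸ hk)

lemma onAxis_fin_two {K : Type*} [Zero K] {x : Fin 2 → K} : OnAxis x ↔ ∃ i, x i = 0 := by
  simp only [OnAxis, Fin.exists_fin_two, Fin.forall_fin_two, ne_eq, not_true_eq_false,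
    IsEmpty.forall_iff, true_and, and_true, one_ne_zero, zero_ne_one, not_false_eq_true,
    forall_const]
  exact or_comm

lemma onAxis_single [DecidableEq ι] {K : Type*} [Zero K] (i : ι) (c : K) :
    OnAxis (Pi.single i c) :=
  ⟨i, fun _ hk => Pi.single_eq_of_ne (M := fun _ => K) hk c⟩

lemma exists_perm_of_onAxis [DecidableEq ι] [Finite ι] {K : Type*} [Field K]
    {M : (ι → K) →ₗ[K] ι → K} (hinj : Function.Injective M)
    (haxis : ∀ j, OnAxis (M (Pi.single j 1))) :
    ∃ τ : Equiv.Perm ι, ∀ j, M (Pi.single j 1) (τ j) ≠ 0 := by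
  choose τ hτ using haxis
  have hne j : M (Pi.single j 1) (τ j) ≠ 0 := fun h0 => by
    have hzero : M (Pi.single j 1) = 0 := funext fun k => by
      rcases eq_or_ne k (τ j) with rfl | hk
      exacts [h0, hτ j k hk]
    exact one_ne_zero (Pi.single_eq_zero_iff.1 ((map_eq_zero_iff M hinj).1 hzero))
  have hτinj : Function.Injective τ := fun i j hij => by
    by_contra hne_ij
    have hparallel : M (M (Pi.single j 1) (τ j) • Pi.single i 1) =
        M (M (Pi.single i 1) (τ i) • Pi.single j 1) := funext fun k => by
      rw [map_smul, map_smul, Pi.smul_apply, Pi.smul_apply, smul_eq_mul, smul_eq_mul]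
      rcases eq_or_ne k (τ i) with rfl | hk
      · rw [← hij, mul_comm]
      · rw [hτ i k hk, hτ j k (hij ▸ hk), mul_zero, mul_zero]
    have hcoord := congrFun (hinj hparallel) i
    rw [Pi.smul_apply, Pi.smul_apply, Pi.single_eq_same, Pi.single_eq_of_ne hne_ij, smul_zero,
      smul_eq_mul, mul_one] at hcoord
    exact hne j hcoord
  exact ⟨Equiv.ofBijective τ (Finite.injective_iff_bijective.1 hτinj), hne⟩

lemma apply_eq_apply_iff_of_fderiv_single [DecidableEq ι] [Finite ι] {h : (ι → ℝ) → ℝ}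
    {h' : (ι → ℝ) → (ι → ℝ) →L[ℝ] ℝ} {s : Set (ι → ℝ)} (hs : Convex ℝ s)
    (hh : ∀ z ∈ s, HasFDerivAt h (h' z) z) {i : ι} (hne : ∀ z ∈ s, h' z (Pi.single i 1) ≠ 0)
    (hzero : ∀ z ∈ s, ∀ j ≠ i, h' z (Pi.single j 1) = 0) {z w : ι → ℝ} (hz : z ∈ s)
    (hw : w ∈ s) : h z = h w ↔ z i = w i := by
  cases nonempty_fintype ι
  obtain ⟨x, hx, hmvt⟩ := domain_mvt (fun y hy => (hh y hy).hasFDerivWithinAt) hs hw hz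
  have hxs : x ∈ s := hs.segment_subset hw hz hx
  have hsum : h z - h w = (z i - w i) * h' x (Pi.single i 1) := by
    rw [hmvt, pi_eq_sum_univ' (z - w), map_sum, Fintype.sum_eq_single i]
    · rw [map_smul, smul_eq_mul, Pi.sub_apply]
    · intro j hj
      rw [map_smul, hzero x hxs j hj, smul_zero]
  rw [← sub_eq_zero, hsum, mul_eq_zero, or_iff_left (hne x hxs), sub_eq_zero]

variable [Fintype ι]

lemma exists_perm_apply_eq_apply_iff [DecidableEq ι] {H : (ι → ℝ) → ι → ℝ} {z₀ : ι → ℝ}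
    (hH : ContDiffAt ℝ 1 H z₀) (hinj : Function.Injective (fderiv ℝ H z₀))
    (haxis : ∀ᶠ z in 𝓝 z₀, ∀ j, OnAxis (fderiv ℝ H z (Pi.single j 1))) :
    ∃ τ : Equiv.Perm ι, ∃ s ∈ 𝓝 z₀, ∀ z ∈ s, ∀ w ∈ s, ∀ i,
      H z (τ i) = H w (τ i) ↔ z i = w i := by
  obtain ⟨τ, hτ⟩ :=
    exists_perm_of_onAxis (M := (fderiv ℝ H z₀ : (ι → ℝ) →ₗ[ℝ] ι → ℝ)) hinj haxis.self_of_nhds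
  have hcont j : ContinuousAt (fun z => fderiv ℝ H z (Pi.single j 1) (τ j)) z₀ :=
    (continuous_apply (τ j)).continuousAt.comp
      ((hH.continuousAt_fderiv one_ne_zero).clm_apply continuousAt_const)
  have hne : ∀ᶠ z in 𝓝 z₀, ∀ j, fderiv ℝ H z (Pi.single j 1) (τ j) ≠ 0 :=
    Filter.eventually_all.2 fun j => (hcont j).eventually_ne (hτ j)
  have hdiff : ∀ᶠ z in 𝓝 z₀, DifferentiableAt ℝ H z :=
    (hH.eventually (by simp)).mono fun z hz => hz.differentiableAt one_ne_zero
  obtain ⟨ε, hε, hball⟩ := Metric.mem_nhds_iff.1 (haxis.and (hne.and hdiff))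
  refine ⟨τ, Metric.ball z₀ ε, Metric.ball_mem_nhds z₀ hε, fun z hz w hw i => ?_⟩
  refine apply_eq_apply_iff_of_fderiv_single (h := fun z => H z (τ i)) (convex_ball z₀ ε)
    (fun y hy => hasFDerivAt_pi'.1 (hball hy).2.2.hasFDerivAt (τ i)) (fun y hy => (hball hy).2.1 i)
    (fun y hy j hj => ?_) hz hw
  exact ((hball hy).1 j).apply_eq_zero ((hball hy).2.1 j) (τ.injective.ne hj.symm)

lemma exists_contDiffAt_rightInverse {E F : Type*} [NormedAddCommGroup E] [NormedSpace ℝ E]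
    [CompleteSpace E] [NormedAddCommGroup F] [NormedSpace ℝ F] [CompleteSpace F] {u : E → F}
    {p : E} (hu : ContDiffAt ℝ 1 u p) (hbij : Function.Bijective (fderiv ℝ u p)) :
    ∃ g : F → E, ContDiffAt ℝ 1 g (u p) ∧ g (u p) = p ∧ ∀ᶠ z in 𝓝 (u p), u (g z) = z := by
  let e : E ≃L[ℝ] F := .ofBijective (fderiv ℝ u p) (LinearMap.ker_eq_bot.2 hbij.1)
    (LinearMap.range_eq_top.2 hbij.2)
  have he : HasFDerivAt u (e : E →L[ℝ] F) p :=
    (ContinuousLinearEquiv.coe_ofBijective (fderiv ℝ u p) _ _).symm ▸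
      (hu.differentiableAt one_ne_zero).hasFDerivAt
  exact ⟨hu.localInverse he one_ne_zero, hu.to_localInverse he one_ne_zero,
    hu.localInverse_apply_image he one_ne_zero,
    (hu.hasStrictFDerivAt' he one_ne_zero).eventually_right_inverse⟩

variable {E : Type*} [NormedAddCommGroup E] [NormedSpace ℝ E]

lemma eventually_fderiv_rightInverse {F : Type*} [NormedAddCommGroup F] [NormedSpace ℝ F]
    {u : E → F} {g : F → E} {z₀ : F} (hu : ContDiffAt ℝ 1 u (g z₀)) (hg : ContDiffAt ℝ 1 g z₀)
    (hright : ∀ᶠ z in 𝓝 z₀, u (g z) = z) :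
    ∀ᶠ z in 𝓝 z₀, ∀ v, fderiv ℝ u (g z) (fderiv ℝ g z v) = v := by
  have hu' := hg.continuousAt.eventually (hu.eventually (by simp))
  filter_upwards [hu', hg.eventually (by simp), hright.eventually_nhds] with z huz hgz hz v
  have hcomp := (huz.differentiableAt one_ne_zero).hasFDerivAt.comp z
    (hgz.differentiableAt one_ne_zero).hasFDerivAt
  have hid : HasFDerivAt (u ∘ g) (.id ℝ F) z := (hasFDerivAt_id z).congr_of_eventuallyEq hz
  exact congrArg (· v) (hcomp.unique hid)

lemma exists_perm_comp_rightInverse_apply_eq_iff {u u' : E → ι → ℝ} {g : (ι → ℝ) → E}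
    {z₀ : ι → ℝ} (hu : ContDiffAt ℝ 1 u (g z₀)) (hu' : ContDiffAt ℝ 1 u' (g z₀))
    (hg : ContDiffAt ℝ 1 g z₀) (hright : ∀ᶠ z in 𝓝 z₀, u (g z) = z)
    (hinj : Function.Injective (fderiv ℝ u' (g z₀)))
    (haxis : ∀ᶠ q in 𝓝 (g z₀), ∀ X, OnAxis (fderiv ℝ u q X) → OnAxis (fderiv ℝ u' q X)) :
    ∃ τ : Equiv.Perm ι, ∃ s ∈ 𝓝 z₀, ∀ z ∈ s, ∀ w ∈ s, ∀ i,
      u' (g z) (τ i) = u' (g w) (τ i) ↔ z i = w i := by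
  classical
  have hderiv := eventually_fderiv_rightInverse hu hg hright
  have hchain : ∀ᶠ z in 𝓝 z₀, ∀ v,
      fderiv ℝ (u' ∘ g) z v = fderiv ℝ u' (g z) (fderiv ℝ g z v) := by
    filter_upwards [hg.continuousAt.eventually (hu'.eventually (by simp)), hg.eventually (by simp)]
      with z hz hgz v
    rw [fderiv_comp z (hz.differentiableAt one_ne_zero) (hgz.differentiableAt one_ne_zero),
      ContinuousLinearMap.comp_apply]
  refine exists_perm_apply_eq_apply_iff (H := u' ∘ g) (hu'.comp z₀ hg) (fun v w hvw => ?_) ?_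
  · rw [hchain.self_of_nhds, hchain.self_of_nhds] at hvw
    rw [← hderiv.self_of_nhds v, hinj hvw, hderiv.self_of_nhds]
  · filter_upwards [hchain, hderiv, hg.continuousAt.eventually haxis] with z hz hz' hza j
    rw [hz]
    exact hza _ ((hz' (Pi.single j 1)).symm ▸ onAxis_single j 1)

lemma exists_perm_coordinate_rectangle [CompleteSpace E] {u u' : E → ι → ℝ} {p : E}
    (hu : ContDiffAt ℝ 1 u p) (hu' : ContDiffAt ℝ 1 u' p)
    (hbij : Function.Bijective (fderiv ℝ u p)) (hinj : Function.Injective (fderiv ℝ u' p))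
    (haxis : ∀ᶠ q in 𝓝 p, ∀ X, OnAxis (fderiv ℝ u q X) → OnAxis (fderiv ℝ u' q X)) {W : Set E}
    (hW : W ∈ 𝓝 p) :
    ∃ (τ : Equiv.Perm ι) (I : ι → Set ℝ) (k : ι → ℝ → ℝ), (∀ i, (I i).Infinite) ∧
      (∀ i, Set.InjOn (k i) (I i)) ∧
      ∀ t, (∀ i, t i ∈ I i) → ∃ q ∈ W, u q = t ∧ ∀ i, u' q (τ i) = k i (t i) := by
  classical
  obtain ⟨g, hg, hgp, hright⟩ := exists_contDiffAt_rightInverse hu hbij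
  obtain ⟨τ, s, hs, hτ⟩ := exists_perm_comp_rightInverse_apply_eq_iff (hgp.symm ▸ hu)
    (hgp.symm ▸ hu') hg hright (hgp.symm ▸ hinj) (hgp.symm ▸ haxis)
  have hgW : ∀ᶠ z in 𝓝 (u p), g z ∈ W := hg.continuousAt (by rwa [hgp])
  have hrect := Filter.inter_mem hs (Filter.inter_mem hgW hright)
  rw [nhds_pi, Filter.mem_pi'] at hrect
  obtain ⟨J, I, hI, hIs⟩ := hrect
  have hbox t (ht : ∀ i, t i ∈ I i) : t ∈ s ∧ g t ∈ W ∧ u (g t) = t := hIs fun i _ => ht i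
  have hline i t (ht : t ∈ I i) : Function.update (u p) i t ∈ s :=
    (hbox _ ((Function.forall_update_iff (u p) fun j x => x ∈ I j).2
      ⟨ht, fun j _ => mem_of_mem_nhds (hI j)⟩)).1
  refine ⟨τ, I, fun i t => u' (g (Function.update (u p) i t)) (τ i),
    fun i => infinite_of_mem_nhds _ (hI i), fun i x hx y hy hxy => ?_, fun t ht => ?_⟩
  · simpa only [Function.update_self] using (hτ _ (hline i x hx) _ (hline i y hy) i).1 hxy
  · obtain ⟨hts, htW, hut⟩ := hbox t ht
    refine ⟨g t, htW, hut, fun i => (hτ _ hts _ (hline i _ (ht i)) i).2 ?_⟩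
    rw [Function.update_self]

end CoordinateNet

section ConicParametrization

lemma hasDerivAt_conic {V : Type*} [NormedAddCommGroup V] [NormedSpace ℝ V] (b : Fin 3 → V)
    (t : ℝ) : HasDerivAt (conic b) (conicDeriv b t) t := by
  have hlin := (hasDerivAt_id t).smul_const (b 1)
  have hquad := (((hasDerivAt_id t).pow 2).div_const 2).smul_const (b 2)
  exact ((hlin.const_add (b 0)).add hquad).congr_deriv (by simp [conicDeriv])

lemma contDiff_conic {V : Type*} [NormedAddCommGroup V] [NormedSpace ℝ V] (b : Fin 3 → V)
    {n : WithTop ℕ∞} : ContDiff ℝ n (conic b : ℝ → V) := by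
  unfold conic
  fun_prop

lemma contDiff_form_left (y : R42) {n : WithTop ℕ∞} : ContDiff ℝ n fun x => form x y :=
  (form.flip y).toContinuousLinearMap.contDiff

/-- On the open set `W`, the contact elements `f q` are spanned by points of the conics of null
lines in the two planes of `Δ`, with smooth parameters `u q` relative to the null frames `b`. -/
structure IsConicParametrization (Δ : DupinCyclide) (W : Set (ℝ × ℝ))
    (f : ℝ × ℝ → Submodule ℝ R42) (b : Fin 2 → Fin 3 → R42) (u : ℝ × ℝ → Fin 2 → ℝ) : Prop where
  isOpen : IsOpen W
  isNullFrame : ∀ i, IsNullFrame form (b i)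
  span_eq_plane : ∀ i, span ℝ (Set.range (b i)) = Δ.plane i
  contDiffOn : ContDiffOn ℝ ∞ u W
  eq_span : ∀ q ∈ W, f q = span ℝ (Set.range fun i => conic (b i) (u q i))

namespace IsConicParametrization

variable {Δ : DupinCyclide} {W : Set (ℝ × ℝ)} {f : ℝ × ℝ → Submodule ℝ R42}
  {b : Fin 2 → Fin 3 → R42} {u : ℝ × ℝ → Fin 2 → ℝ} {q : ℝ × ℝ}

lemma mem_iff (h : IsConicParametrization Δ W f b u) (hq : q ∈ W) {x : R42} :
    x ∈ f q ↔ ∃ c : Fin 2 → ℝ, ∑ i, c i • conic (b i) (u q i) = x := by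
  rw [h.eq_span q hq, mem_span_range_iff_exists_fun]

lemma conic_mem (h : IsConicParametrization Δ W f b u) (hq : q ∈ W) (i : Fin 2) :
    conic (b i) (u q i) ∈ f q := by
  rw [h.eq_span q hq]
  exact subset_span ⟨i, rfl⟩

lemma form_eq_zero (h : IsConicParametrization Δ W f b u) {i j : Fin 2} (hij : i ≠ j) {x y : R42}
    (hx : x ∈ span ℝ (Set.range (b i))) (hy : y ∈ span ℝ (Set.range (b j))) : form x y = 0 :=
  Δ.form_eq_zero hij (h.span_eq_plane i ▸ hx) (h.span_eq_plane j ▸ hy)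

lemma form_conic_conic (h : IsConicParametrization Δ W f b u) (t : Fin 2 → ℝ) (i j : Fin 2) :
    form (conic (b i) (t i)) (conic (b j) (t j)) = 0 := by
  rcases eq_or_ne i j with rfl | hij
  · exact (h.isNullFrame i).apply_conic_conic _
  · exact h.form_eq_zero hij (conic_mem_span _ _) (conic_mem_span _ _)

lemma form_conic_conicDeriv (h : IsConicParametrization Δ W f b u) (t : Fin 2 → ℝ)
    (i j : Fin 2) : form (conic (b i) (t i)) (conicDeriv (b j) (t j)) = 0 := by
  rcases eq_or_ne i j with rfl | hij
  · exact (h.isNullFrame i).apply_conic_conicDeriv _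
  · exact h.form_eq_zero hij (conic_mem_span _ _) (conicDeriv_mem_span _ _)

lemma form_sum_conicDeriv (h : IsConicParametrization Δ W f b u) (t c d : Fin 2 → ℝ)
    (i : Fin 2) : form (∑ j, (c j • conic (b j) (t j) + d j • conicDeriv (b j) (t j)))
      (conicDeriv (b i) (t i)) = d i := by
  simp only [map_sum, map_add, map_smul, LinearMap.sum_apply, LinearMap.add_apply,
    LinearMap.smul_apply, h.form_conic_conicDeriv, smul_zero, zero_add]
  rw [Fintype.sum_eq_single i, (h.isNullFrame i).apply_conicDeriv_conicDeriv, smul_eq_mul, mul_one]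
  intro j hj
  rw [h.form_eq_zero hj (conicDeriv_mem_span _ _) (conicDeriv_mem_span _ _), smul_zero]

lemma form_sum_conic_two (h : IsConicParametrization Δ W f b u) (t c : Fin 2 → ℝ) (i : Fin 2) :
    form (∑ j, c j • conic (b j) (t j)) (b i 2) = -c i := by
  simp only [map_sum, map_smul, LinearMap.sum_apply, LinearMap.smul_apply]
  rw [Fintype.sum_eq_single i, (h.isNullFrame i).apply_conic_two, smul_eq_mul, mul_neg_one]
  intro j hj
  rw [h.form_eq_zero hj (conic_mem_span _ _) (subset_span ⟨2, rfl⟩), smul_zero]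

lemma linearIndependent (h : IsConicParametrization Δ W f b u) (t : Fin 2 → ℝ) :
    LinearIndependent ℝ fun i => conic (b i) (t i) := by
  refine Fintype.linearIndependent_iff.2 fun c hc i => ?_
  rw [← neg_eq_zero, ← h.form_sum_conic_two t c i, hc, map_zero, LinearMap.zero_apply]

lemma mem_contactElements (h : IsConicParametrization Δ W f b u) (hq : q ∈ W) :
    f q ∈ Δ.contactElements :=
  ⟨_, fun i => ⟨h.span_eq_plane i ▸ conic_mem_span (b i) _, (h.isNullFrame i).conic_ne_zero _,
    (h.isNullFrame i).apply_conic_conic _⟩, h.eq_span q hq⟩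

lemma isContactElement (h : IsConicParametrization Δ W f b u) (hq : q ∈ W) :
    IsContactElement (f q) := by
  constructor
  · rw [h.eq_span q hq, finrank_span_eq_card (h.linearIndependent (u q)), Fintype.card_fin]
  · intro x hx y hy
    obtain ⟨c, rfl⟩ := (h.mem_iff hq).1 hx
    obtain ⟨d, rfl⟩ := (h.mem_iff hq).1 hy
    simp only [map_sum, map_smul, LinearMap.sum_apply, LinearMap.smul_apply, h.form_conic_conic,
      smul_zero, Finset.sum_const_zero]

lemma sum_mem_iff (h : IsConicParametrization Δ W f b u) (hq : q ∈ W) (c d : Fin 2 → ℝ) :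
    ∑ i, (c i • conic (b i) (u q i) + d i • conicDeriv (b i) (u q i)) ∈ f q ↔ d = 0 := by
  constructor
  · refine fun hmem => funext fun i => ?_
    obtain ⟨e, he⟩ := (h.mem_iff hq).1 hmem
    rw [← h.form_sum_conicDeriv (u q) c d i, ← he]
    simp only [map_sum, map_smul, LinearMap.sum_apply, LinearMap.smul_apply,
      h.form_conic_conicDeriv, smul_zero, Finset.sum_const_zero, Pi.zero_apply]
  · rintro rfl
    simp only [Pi.zero_apply, zero_smul, add_zero]
    exact (h.mem_iff hq).2 ⟨c, rfl⟩

lemma hasFDerivAt_conic (h : IsConicParametrization Δ W f b u) (hq : q ∈ W) (i : Fin 2) :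
    HasFDerivAt (fun q => conic (b i) (u q i))
      (((ContinuousLinearMap.proj i).comp (fderiv ℝ u q)).smulRight (conicDeriv (b i) (u q i)))
      q := by
  have hu : DifferentiableAt ℝ u q :=
    (h.contDiffOn.contDiffAt (h.isOpen.mem_nhds hq)).differentiableAt (by simp)
  exact ((hasDerivAt_conic (b i) (u q i)).hasFDerivAt.comp q
    (hasFDerivAt_pi'.1 hu.hasFDerivAt i)).congr_fderiv rfl

lemma contDiffOn_conic (h : IsConicParametrization Δ W f b u) (i : Fin 2) :
    ContDiffOn ℝ ∞ (fun q => conic (b i) (u q i)) W :=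
  (contDiff_conic (b i)).comp_contDiffOn (contDiffOn_pi.1 h.contDiffOn i)

lemma isSmoothSectionAt_conic (h : IsConicParametrization Δ W f b u) (hq : q ∈ W) (i : Fin 2) :
    IsSmoothSectionAt f q fun q => conic (b i) (u q i) :=
  ⟨W, h.isOpen, hq, h.contDiffOn_conic i, fun _ hq' => h.conic_mem hq' i⟩

lemma fderiv_conic_mem_iff (h : IsConicParametrization Δ W f b u) (hq : q ∈ W) (X : ℝ × ℝ)
    (i : Fin 2) : fderiv ℝ (fun q => conic (b i) (u q i)) q X ∈ f q ↔ fderiv ℝ u q X i = 0 := by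
  have hsum : fderiv ℝ (fun q => conic (b i) (u q i)) q X =
      ∑ j, ((0 : ℝ) • conic (b j) (u q j) +
        Pi.single (M := fun _ => ℝ) i (fderiv ℝ u q X i) j • conicDeriv (b j) (u q j)) := by
    rw [(h.hasFDerivAt_conic hq i).fderiv, Fintype.sum_eq_single i]
    · rw [Pi.single_eq_same, zero_smul, zero_add]
      rfl
    · intro j hj
      rw [Pi.single_eq_of_ne hj, zero_smul, zero_smul, add_zero]
  rw [hsum, h.sum_mem_iff hq fun _ => 0, Pi.single_eq_zero_iff]

lemma exists_fderiv_section (h : IsConicParametrization Δ W f b u) (hq : q ∈ W)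
    {s : ℝ × ℝ → R42} (hs : IsSmoothSectionAt f q s) (X : ℝ × ℝ) :
    ∃ c c' : Fin 2 → ℝ, s q = ∑ i, c i • conic (b i) (u q i) ∧
      fderiv ℝ s q X = ∑ i, (c' i • conic (b i) (u q i) +
        (c i * fderiv ℝ u q X i) • conicDeriv (b i) (u q i)) := by
  obtain ⟨V, hV, hqV, hsV, hsf⟩ := hs
  let c i (q' : ℝ × ℝ) : ℝ := -form (s q') (b i 2)
  have hc i : DifferentiableAt ℝ (c i) q :=
    (((contDiff_form_left (b i 2)).comp_contDiffOn hsV).contDiffAt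
      (hV.mem_nhds hqV)).neg.differentiableAt (by simp)
  have hsum : ∀ q' ∈ W ∩ V, s q' = ∑ i, c i q' • conic (b i) (u q' i) := fun q' hq' => by
    obtain ⟨e, he⟩ := (h.mem_iff hq'.1).1 (hsf q' hq'.2)
    simp only [c, ← he, h.form_sum_conic_two, neg_neg]
  have hderiv := (HasFDerivAt.fun_sum (u := Finset.univ) fun i _ =>
    (hc i).hasFDerivAt.smul (h.hasFDerivAt_conic hq i)).congr_of_eventuallyEq
      (Filter.eventually_of_mem ((h.isOpen.inter hV).mem_nhds ⟨hq, hqV⟩) hsum)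
  refine ⟨fun i => c i q, fun i => fderiv ℝ (c i) q X, hsum q ⟨hq, hqV⟩, ?_⟩
  rw [hderiv.fderiv]
  simp only [sum_apply, add_apply, _root_.smul_apply, ContinuousLinearMap.smulRight_apply,
    smul_smul]
  exact Finset.sum_congr rfl fun i _ => add_comm _ _

lemma forall_fderiv_section_mem_iff (h : IsConicParametrization Δ W f b u) (hq : q ∈ W)
    (X : ℝ × ℝ) :
    (∀ s, IsSmoothSectionAt f q s → fderiv ℝ s q X ∈ f q) ↔ fderiv ℝ u q X = 0 := by
  constructor
  · exact fun hX => funext fun i =>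
      (h.fderiv_conic_mem_iff hq X i).1 (hX _ (h.isSmoothSectionAt_conic hq i))
  · intro hX s hs
    obtain ⟨c, c', -, hsX⟩ := h.exists_fderiv_section hq hs X
    rw [hsX, h.sum_mem_iff hq, hX]
    exact funext fun i => mul_zero (c i)

lemma isCurvatureDirection_iff (h : IsConicParametrization Δ W f b u) (hq : q ∈ W) (X : ℝ × ℝ) :
    IsCurvatureDirection f q X ↔ X ≠ 0 ∧ OnAxis (fderiv ℝ u q X) := by
  rw [onAxis_fin_two]
  refine and_congr_right fun _ => ⟨?_, ?_⟩
  · rintro ⟨s, hs, hs0, hX⟩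
    obtain ⟨c, c', hsq, hsX⟩ := h.exists_fderiv_section hq hs X
    rw [hsX, h.sum_mem_iff hq] at hX
    by_contra! hne
    refine hs0 (hsq.trans (Finset.sum_eq_zero fun i _ => ?_))
    rw [(mul_eq_zero.1 (congrFun hX i)).resolve_right (hne i), zero_smul]
  · rintro ⟨i, hi⟩
    exact ⟨_, h.isSmoothSectionAt_conic hq i, (h.isNullFrame i).conic_ne_zero _,
      (h.fderiv_conic_mem_iff hq X i).2 hi⟩

lemma injective_fderiv_iff (h : IsConicParametrization Δ W f b u) (hq : q ∈ W) :
    Function.Injective (fderiv ℝ u q) ↔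
      ∀ X, (∀ s, IsSmoothSectionAt f q s → fderiv ℝ s q X ∈ f q) → X = 0 := by
  simp only [injective_iff_map_eq_zero, h.forall_fderiv_section_mem_iff hq]

lemma isLegendreMap (h : IsConicParametrization Δ W f b u)
    (hu : ∀ p ∈ W, Function.Injective (fderiv ℝ u p)) : IsLegendreMap W f where
  contactElement _ hp := h.isContactElement hp
  smooth p hp := by
    refine ⟨W, _, _, h.isOpen, hp, h.contDiffOn_conic 0, h.contDiffOn_conic 1, fun q hq => ?_⟩
    rw [h.eq_span q hq, ← Matrix.range_cons_cons_empty _ _ ![]]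
    congr 2
    exact funext (Fin.forall_fin_two.2 ⟨rfl, rfl⟩)
  contact p hp s t hs ht X := by
    obtain ⟨c, c', hsp, -⟩ := h.exists_fderiv_section hp hs X
    obtain ⟨d, d', -, htX⟩ := h.exists_fderiv_section hp ht X
    rw [hsp, htX]
    simp only [map_sum, map_add, map_smul, LinearMap.sum_apply, LinearMap.smul_apply,
      h.form_conic_conic, h.form_conic_conicDeriv, smul_zero, add_zero, Finset.sum_const_zero]
  immersion p hp := (h.injective_fderiv_iff hp).1 (hu p hp)

end IsConicParametrization

end ConicParametrization

section Existence

lemma DupinCyclide.eq_span_conic {Δ : DupinCyclide} {c : Submodule ℝ R42}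
    (hc : c ∈ Δ.contactElements) {b : Fin 2 → Fin 3 → R42} (hb : ∀ i, IsNullFrame form (b i))
    (hbΔ : ∀ i, span ℝ (Set.range (b i)) = Δ.plane i) {x : Fin 2 → R42} (hx : ∀ i, x i ∈ c)
    (h2 : ∀ i, form (x i) (b i 2) ≠ 0) :
    c = span ℝ (Set.range fun i => conic (b i) (conicParam form (b i) (x i))) := by
  obtain ⟨s, hs, rfl⟩ := hc
  rw [span_range_eq_iSup, span_range_eq_iSup]
  refine iSup_congr fun i => ?_
  obtain ⟨e, he⟩ := (mem_span_range_iff_exists_fun ℝ).1 (hx i)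
  have hform k : form (x i) (b i k) = form (e i • s i) (b i k) := by
    simp only [← he, map_sum, LinearMap.sum_apply]
    refine Fintype.sum_eq_single i fun j hj => ?_
    exact Δ.form_eq_zero hj (smul_mem _ _ (hs j).1) (hbΔ i ▸ subset_span ⟨k, rfl⟩)
  have hne := h2 i
  rw [hform, map_smul, LinearMap.smul_apply, smul_eq_mul] at hne
  have hparam : conicParam form (b i) (x i) = conicParam form (b i) (s i) := by
    rw [← conicParam_smul form (b i) (left_ne_zero_of_mul hne) (s i)]
    simp only [conicParam, hform]
  have hs2 : form (s i) (b i 2) ≠ 0 := right_ne_zero_of_mul hne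
  rw [hparam, ← span_singleton_smul_eq (neg_ne_zero.2 hs2).isUnit (conic (b i) _),
    ← (hb i).eq_smul_conic (hbΔ i ▸ (hs i).1) (hs i).2.2 hs2]

lemma IsLegendreMap.exists_isSmoothSectionAt {U : Set (ℝ × ℝ)} {f : ℝ × ℝ → Submodule ℝ R42}
    (hf : IsLegendreMap U f) {p : ℝ × ℝ} (hp : p ∈ U) {x : R42} (hx : x ∈ f p) :
    ∃ s, IsSmoothSectionAt f p s ∧ s p = x := by
  obtain ⟨W, s, t, hW, hpW, hs, ht, hspan⟩ := hf.smooth p hp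
  obtain ⟨c, d, hcd⟩ := mem_span_pair.1 (hspan p hpW ▸ hx)
  refine ⟨fun q => c • s q + d • t q,
    ⟨W, hW, hpW, (hs.const_smul c).add (ht.const_smul d), fun q hq => ?_⟩, hcd⟩
  exact hspan q hq ▸ mem_span_pair.2 ⟨c, d, rfl⟩

lemma IsLegendreMap.exists_isConicParametrization {U : Set (ℝ × ℝ)}
    {f : ℝ × ℝ → Submodule ℝ R42} (hf : IsLegendreMap U f) (hU : IsOpen U) {Δ : DupinCyclide}
    (hΔ : ∀ p ∈ U, f p ∈ Δ.contactElements) {p : ℝ × ℝ} (hp : p ∈ U) :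
    ∃ W b u, p ∈ W ∧ IsConicParametrization Δ W f b u := by
  obtain ⟨s, hs, hfp⟩ := hΔ p hp
  have hframe i : ∃ b, IsNullFrame form b ∧ span ℝ (Set.range b) = Δ.plane i ∧
      form (s i) (b 2) ≠ 0 := by
    obtain ⟨b, hb, hbΔ⟩ := (Δ.isPlane21 i).exists_isNullFrame
    obtain ⟨b', hb', hrange, h2⟩ :=
      hb.exists_apply_two_ne_zero (hbΔ ▸ (hs i).1) (hs i).2.1 (hs i).2.2
    exact ⟨b', hb', hrange ▸ hbΔ, h2⟩
  choose b hb hbΔ hs2 using hframe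
  choose R hR hRp using fun i =>
    hf.exists_isSmoothSectionAt hp (hfp ▸ subset_span ⟨i, rfl⟩ : s i ∈ f p)
  choose V hV hpV hRV hRf using hR
  have hform i y : ContDiffOn ℝ ∞ (fun q => form (R i q) y) (V i) :=
    (contDiff_form_left y).comp_contDiffOn (hRV i)
  let W : Set (ℝ × ℝ) := U ∩ ⋂ i, V i ∩ (fun q => form (R i q) (b i 2)) ⁻¹' {0}ᶜ
  have hWV i : W ⊆ V i := fun q hq => (Set.mem_iInter.1 hq.2 i).1
  have hW2 i : ∀ q ∈ W, form (R i q) (b i 2) ≠ 0 := fun q hq => (Set.mem_iInter.1 hq.2 i).2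
  refine ⟨W, b, fun q i => conicParam form (b i) (R i q), ⟨hp, Set.mem_iInter.2 fun i => ?_⟩,
    ?_, hb, hbΔ, contDiffOn_pi.2 fun i => ?_, fun q hq => ?_⟩
  · refine ⟨hpV i, ?_⟩
    rw [Set.mem_preimage, hRp]
    exact hs2 i
  · exact hU.inter (isOpen_iInter_of_finite fun i =>
      (hform i _).continuousOn.isOpen_inter_preimage (hV i) isOpen_compl_singleton)
  · exact ((hform i _).mono (hWV i)).neg.div ((hform i _).mono (hWV i)) (hW2 i)
  · exact DupinCyclide.eq_span_conic (hΔ q hq.1) hb hbΔ (fun i => hRf i q (hWV i hq))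
      fun i => hW2 i q hq

end Existence

section Ribaucour

namespace DupinCyclide

variable {Δ Δ' : DupinCyclide}

/-- The same Dupin cyclide with another labelling of its splitting. -/
def relabel (Δ : DupinCyclide) (τ : Equiv.Perm (Fin 2)) : DupinCyclide where
  plane i := Δ.plane (τ i)
  isPlane21 _ := Δ.isPlane21 _
  isCompl := Δ.isCompl_plane (τ.injective.ne zero_ne_one)
  orthogonal _ hx _ hy := Δ.form_eq_zero (τ.injective.ne zero_ne_one) hx hy

lemma contactElements_relabel (Δ : DupinCyclide) (τ : Equiv.Perm (Fin 2)) :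
    (Δ.relabel τ).contactElements = Δ.contactElements := by
  ext c
  constructor
  · rintro ⟨s, hs, rfl⟩
    refine ⟨s ∘ τ.symm, fun i => ?_, by rw [τ.symm.surjective.range_comp]⟩
    simpa only [relabel, Function.comp_apply, τ.apply_symm_apply] using hs (τ.symm i)
  · rintro ⟨s, hs, rfl⟩
    exact ⟨s ∘ τ, fun i => hs (τ i), by rw [τ.surjective.range_comp]⟩

lemma ribaucourRelated_relabel_right (τ : Equiv.Perm (Fin 2)) :
    Δ.RibaucourRelated (Δ'.relabel τ) ↔ Δ.RibaucourRelated Δ' := by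
  simp only [RibaucourRelated, contactElements_relabel]

end DupinCyclide

lemma IsRibaucourPair.exists_perm_coordinates {U W W' : Set (ℝ × ℝ)}
    {f f' : ℝ × ℝ → Submodule ℝ R42} (h : IsRibaucourPair U f f') (hU : IsOpen U)
    {Δ Δ' : DupinCyclide} {b b' : Fin 2 → Fin 3 → R42} {u u' : ℝ × ℝ → Fin 2 → ℝ}
    (hf : IsConicParametrization Δ W f b u) (hf' : IsConicParametrization Δ' W' f' b' u')
    {p : ℝ × ℝ} (hp : p ∈ U ∩ (W ∩ W')) :
    ∃ (τ : Equiv.Perm (Fin 2)) (I : Fin 2 → Set ℝ) (k : Fin 2 → ℝ → ℝ), (∀ i, (I i).Infinite) ∧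
      (∀ i, Set.InjOn (k i) (I i)) ∧ ∀ t : Fin 2 → ℝ, (∀ i, t i ∈ I i) →
        ∃ q ∈ U ∩ (W ∩ W'), u q = t ∧ ∀ i, u' q (τ i) = k i (t i) := by
  have hmem : U ∩ (W ∩ W') ∈ 𝓝 p := (hU.inter (hf.isOpen.inter hf'.isOpen)).mem_nhds hp
  have hinj := (hf.injective_fderiv_iff hp.2.1).2 (h.legendre_left.immersion p hp.1)
  have hinj' := (hf'.injective_fderiv_iff hp.2.2).2 (h.legendre_right.immersion p hp.1)
  have hsurj := (LinearMap.injective_iff_surjective_of_finrank_eq_finrank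
    (f := (fderiv ℝ u p).toLinearMap) (by simp)).1 hinj
  have haxis : ∀ᶠ q in 𝓝 p, ∀ X, OnAxis (fderiv ℝ u q X) → OnAxis (fderiv ℝ u' q X) := by
    filter_upwards [hmem] with q hq X hX
    rcases eq_or_ne X 0 with rfl | hX0
    · rwa [map_zero, ← map_zero (fderiv ℝ u q)]
    · have hcurv := (hf.isCurvatureDirection_iff hq.2.1 X).2 ⟨hX0, hX⟩
      exact ((hf'.isCurvatureDirection_iff hq.2.2 X).1 ((h.curvature q hq.1 X).1 hcurv)).2
  exact exists_perm_coordinate_rectangle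
    ((hf.contDiffOn.contDiffAt (hf.isOpen.mem_nhds hp.2.1)).of_le (by simp))
    ((hf'.contDiffOn.contDiffAt (hf'.isOpen.mem_nhds hp.2.2)).of_le (by simp))
    ⟨hinj, hsurj⟩ hinj' haxis hmem

theorem DupinCyclide.RibaucourRelated.exists_lieInversion {Δ Δ' : DupinCyclide}
    (h : Δ.RibaucourRelated Δ') : ∃ τ : Equiv.Perm (Fin 2), ∃ σ, IsLieInversion σ ∧
      ∀ i, Δ'.plane (τ i) = (Δ.plane i).map σ := by
  obtain ⟨U, f, f', hU, ⟨⟨p, hp⟩, -⟩, hfΔ, hfΔ', hrib⟩ := h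
  obtain ⟨W, b, u, hpW, hf⟩ := hrib.legendre_left.exists_isConicParametrization hU hfΔ hp
  obtain ⟨W', b', u', hpW', hf'⟩ := hrib.legendre_right.exists_isConicParametrization hU hfΔ' hp
  obtain ⟨τ, I, k, hI, hk, hrect⟩ := hrib.exists_perm_coordinates hU hf hf' ⟨hp, hpW, hpW'⟩
  have hinf i : Infinite (I i) := (hI i).to_subtype
  refine ⟨τ, DupinCyclide.exists_lieInversion (Δ := Δ) (Δ' := Δ'.relabel τ) (I := fun i => I i)
    (s := fun i t => conic (b i) (t : ℝ)) (s' := fun i t => conic (b' (τ i)) (k i t)) (fun i => ?_)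
    (fun i => ?_) fun t hdisj => ?_⟩
  · rw [← hf.span_eq_plane]
    exact (hf.isNullFrame i).isNullFamily Subtype.val_injective
  · rw [relabel, ← hf'.span_eq_plane]
    exact (hf'.isNullFrame (τ i)).isNullFamily (Set.injOn_iff_injective.1 (hk i))
  · obtain ⟨q, ⟨hqU, hqW, hqW'⟩, hu, hu'⟩ := hrect (fun i => t i) fun i => (t i).2
    have hcommon := hrib.common_sphere q hqU
    have hrange : f' q = span ℝ (Set.range fun i => conic (b' (τ i)) (k i (t i))) := by
      simp only [hf'.eq_span q hqW', ← hu']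
      exact congrArg _ (τ.surjective.range_comp fun i => conic (b' i) (u' q i)).symm
    rw [hf.eq_span q hqW, hrange, hu, hdisj.eq_bot, finrank_bot] at hcommon
    exact zero_ne_one hcommon

lemma IsConicParametrization.of_finTwoArrow {Δ : DupinCyclide} {b : Fin 2 → Fin 3 → R42}
    (hb : ∀ i, IsNullFrame form (b i)) (hbΔ : ∀ i, span ℝ (Set.range (b i)) = Δ.plane i)
    {W : Set (ℝ × ℝ)} (hW : IsOpen W) :
    IsConicParametrization Δ W
      (fun q => span ℝ (Set.range fun i =>
        conic (b i) ((ContinuousLinearEquiv.finTwoArrow ℝ ℝ).symm q i)))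
      b (ContinuousLinearEquiv.finTwoArrow ℝ ℝ).symm :=
  ⟨hW, hb, hbΔ, (ContinuousLinearEquiv.contDiff _).contDiffOn, fun _ _ => rfl⟩

namespace DupinCyclide

lemma exists_form_conic_ne_zero {Δ : DupinCyclide} {b : Fin 2 → Fin 3 → R42}
    (hbΔ : ∀ i, span ℝ (Set.range (b i)) = Δ.plane i) {a : R42} (ha : a ≠ 0) :
    ∃ i, ∃ t : ℝ, form (conic (b i) t) a ≠ 0 := by
  by_contra! h
  refine ha (Δ.eq_zero_of_orthogonal fun i => ?_)
  by_contra hle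
  have hfin := finite_conic_mem (b := b i) (P := LinearMap.ker (form.flip a)) (hbΔ i ▸ hle)
  exact Set.infinite_univ (hfin.subset fun t _ => h i t)

lemma ribaucourRelated_of_plane_eq_map {Δ Δ' : DupinCyclide} {a : R42} (ha : form a a ≠ 0)
    (h : ∀ i, Δ'.plane i = (Δ.plane i).map (lieInversion a)) : Δ.RibaucourRelated Δ' := by
  choose b hb hbΔ using fun i => (Δ.isPlane21 i).exists_isNullFrame
  have hb' i : IsNullFrame form (lieInversion a ∘ b i) := (hb i).lieInversion_comp ha
  have hbΔ' i : span ℝ (Set.range (lieInversion a ∘ b i)) = Δ'.plane i := by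
    rw [Set.range_comp, ← map_span, hbΔ, h]
  have ha0 : a ≠ 0 := by
    rintro rfl
    exact ha (map_zero _)
  obtain ⟨i, t, hit⟩ := exists_form_conic_ne_zero hbΔ ha0
  let u := (ContinuousLinearEquiv.finTwoArrow ℝ ℝ).symm
  have hcont : Continuous fun q => form (conic (b i) (u q i)) a :=
    (contDiff_form_left a (n := 0)).continuous.comp <|
      (contDiff_conic (b i) (n := 0)).continuous.comp <| (continuous_apply i).comp u.continuous
  have hinj (q : ℝ × ℝ) : Function.Injective (fderiv ℝ u q) := by
    rw [u.fderiv]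
    exact u.injective
  let p := u.symm fun _ => t
  obtain ⟨ε, hε, hball⟩ := Metric.eventually_nhds_iff_ball.1 <|
    hcont.continuousAt.eventually_ne (x := p) (by rwa [u.apply_symm_apply])
  have hf := IsConicParametrization.of_finTwoArrow hb hbΔ (Metric.isOpen_ball (x := p) (ε := ε))
  have hf' := IsConicParametrization.of_finTwoArrow hb' hbΔ' (Metric.isOpen_ball (x := p) (ε := ε))
  refine ⟨Metric.ball p ε, _, _, Metric.isOpen_ball,
    (convex_ball _ _).isConnected (Metric.nonempty_ball.2 hε), fun q => hf.mem_contactElements,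
    fun q => hf'.mem_contactElements, hf.isLegendreMap fun q _ => hinj q,
    hf'.isLegendreMap fun q _ => hinj q, fun q hq => ?_, fun q hq X => ?_⟩
  · rw [← map_span_conic]
    exact (hf.isContactElement hq).finrank_inf_map_lieInversion ha (hf.conic_mem hq i) (hball q hq)
  · rw [hf.isCurvatureDirection_iff hq, hf'.isCurvatureDirection_iff hq]

end DupinCyclide

end Ribaucour

end LieSphere

theorem mainTheorem4 (Δ Δ' : LieSphere.DupinCyclide) :
    Δ.RibaucourRelated Δ' ↔
      ∃ τ : Equiv.Perm (Fin 2), ∃ σ : LieSphere.R42 →ₗ[ℝ] LieSphere.R42,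
        LieSphere.IsLieInversion σ ∧ ∀ i : Fin 2, Δ'.plane (τ i) = (Δ.plane i).map σ := by
  constructor
  · exact LieSphere.DupinCyclide.RibaucourRelated.exists_lieInversion
  · rintro ⟨τ, _, ⟨a, ha, rfl⟩, h⟩
    exact (LieSphere.DupinCyclide.ribaucourRelated_relabel_right τ).1
      (LieSphere.DupinCyclide.ribaucourRelated_of_plane_eq_map ha h)
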